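/- **Conventions.** An alphabet is a finite set not containing the special symbol $\varnothing$; $\lambda$ is the empty word; $[n]=\{0,\dots,n\}$ and $[d)=\{0,\dots,d-1\}$. For a language $L\subseteq\Sigma^*$, $L^r=\{x^r\mid x\in L\}$ is the set of reversals of its words. **Parsing expression grammars.** Parsing expressions over disjoint alphabets $\Sigma$ (terminals) and $N$ (non-terminals) are built from the elements of $\Sigma\cup N\cup\{\varepsilon,\mathsf{FAIL}\}$ by $!e$, $\&e$, $e_1e_2$ and $e_1/e_2$. A *parsing expression grammar* (PEG) is $\mathcal G=\langle\Sigma,N,R,S\rangle$, where $R$ assigns a parsing expression to each non-terminal and $S\in N$. The recursive procedure $\mathsf{Rec}(e,x)$, for $x\in\Sigma^*$, returns a prefix of $x$ ("accepts") or $\mathsf{FAIL}$, or loops for ever: $\mathsf{Rec}(\varepsilon,x)=\lambda$; $\mathsf{Rec}(\mathsf{FAIL},x)=\mathsf{FAIL}$; for $a\in\Sigma$, $\mathsf{Rec}(a,x)=a$ if $x$ begins with $a$, and $\mathsf{FAIL}$ otherwise; $\mathsf{Rec}(!e,x)$ is $\lambda$ if $\mathsf{Rec}(e,x)=\mathsf{FAIL}$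 and $\mathsf{FAIL}$ if $e$ accepts $x$; $\mathsf{Rec}(\&e,x)$ is $\lambda$ if $e$ accepts $x$ and $\mathsf{FAIL}$ if $\mathsf{Rec}(e,x)=\mathsf{FAIL}$; $\mathsf{Rec}(e_1e_2,x)$ first calls $\mathsf{Rec}(e_1,x)$ and, if this returns $y_1$ with $x=y_1z$, calls $\mathsf{Rec}(e_2,z)$ and, if this returns $y_2$, returns $y_1y_2$; it returns $\mathsf{FAIL}$ if one of these calls does; $\mathsf{Rec}(e_1/e_2,x)$ is $\mathsf{Rec}(e_1,x)$ if $e_1$ accepts $x$, and $\mathsf{Rec}(e_2,x)$ if $\mathsf{Rec}(e_1,x)=\mathsf{FAIL}$; $\mathsf{Rec}(A,x)=\mathsf{Rec}(R(A),x)$ for $A\in N$. The PEG is *total* if $\mathsf{Rec}(e,x)$ halts for all $e$ and $x$; a total PEG *recognises* the language $\{x\in\Sigma^*\mid\mathsf{Rec}(S,x)=x\}$. **Scaffolds.** For an alphabet $\Gamma$ and $d\ge1$, a $(d,\Gamma)$-scaffold $S$ has a set of nodes $[t]$, for each node $v$ and each $i\in[d)$ an edge $e_v(i)\in[v]\cup\{\varnothing\}$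 (so edges point backwards or to the node itself, or are missing), and for each node $v$ a label $L(v)\in\Gamma\cup\{\varnothing\}$; its top is $t$. A path $p\in[d)^{m}$ from $v$ is followed by taking the edges numbered $p_0,p_1,\dots,p_{m-1}$ in turn; the result is $\varnothing$ if one of them is missing. The $k$-neighbourhood of $v$ is given by $N_0(S,v)=L(v)$, $N_{k+1}(S,v)=(L(v),N_k(S,e_v(0)),\dots,N_k(S,e_v(d-1)))$ and $N_k(S,\varnothing)=\varnothing$. It lies in $\mathcal N_k(d,\Gamma)$, where $\mathcal N_0(d,\Gamma)=\Gamma\cup\{\varnothing\}$ and $\mathcal N_{k+1}(d,\Gamma)=(\Gamma\cup\{\varnothing\})\times(\mathcal N_k(d,\Gamma)\cup\{\varnothing\})^d$. **Scaffolding automata.** A *scaffolding automaton* $\mathcal A=\langle\Sigma,d,\Gamma,k,Q,\delta,q_0,F\rangle$ consists of alphabets $\Sigma$ and $\Gamma$, integers $d\ge1$ and $k\ge0$, a finite set $Q$ of states, $q_0\in Q$, $F\subseteq Q$ and a function $$\delta:Q\times\Sigma\times\mathcal N_k(d,\Gamma)\to Q\times\Gamma\times\bigl([d)^{\le k}\cup\{\mathsf{SELF},\varnothing\}\bigr)^d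 .$$ It starts in state $q_0$ with the scaffold that consists of one unlabelled node $0$ without edges. When it reads $\sigma\in\Sigma$ in state $q$ with a scaffold $S$ of top $t$, and $\delta(q,\sigma,N_k(S,t))=(q',\gamma,p_0,\dots,p_{d-1})$, it moves to state $q'$ and adds to $S$ a new top node $t+1$ with label $\gamma$, whose edge $i$ is the result of following $p_i$ from $t$ in $S$ if $p_i$ is a path, $t+1$ if $p_i=\mathsf{SELF}$, and missing if $p_i=\varnothing$. The language *decided* by $\mathcal A$ is the set of $x\in\Sigma^*$ such that $\mathcal A$, having read $x$ from left to right, is in a state of $F$. **Theorem.** Let $\Sigma$ be an alphabet. A language $L\subseteq\Sigma^*$ is recognised by a total parsing expression grammar if and only if its reverse $L^r$ is decided by some scaffolding automaton. -/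

import Mathlib

/-- Parsing expressions over the terminal alphabet `T` and the non-terminal alphabet `N`. -/
inductive ParsingExpr (T : Type*) (N : Type*) where
  | eps : ParsingExpr T N
  | fail : ParsingExpr T N
  | terminal (a : T) : ParsingExpr T N
  | nonterminal (A : N) : ParsingExpr T N
  /-- negative lookahead, written with an exclamation mark -/
  | not (e : ParsingExpr T N) : ParsingExpr T N
  /-- positive lookahead, written with an ampersand -/
  | and (e : ParsingExpr T N) : ParsingExpr T N
  /-- concatenation -/
  | seq (e₁ e₂ : ParsingExpr T N) : ParsingExpr T N
  /-- prioritised choice, written with a slash -/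
  | choice (e₁ e₂ : ParsingExpr T N) : ParsingExpr T N

/-- A parsing expression grammar with terminal alphabet `T`. The alphabet of non-terminals is a
finite type; as every finite type is in bijection with one in `Type`, taking it there loses no
generality. -/
structure PEG (T : Type*) where
  NT : Type
  finite_NT : Finite NT
  rule : NT → ParsingExpr T NT
  start : NT

namespace PEG

variable {T : Type*}

/-- The recognition procedure, as the graph of a partial function: `G.Rec e x r` says that the
procedure, called on the expression `e` and the input `x`, halts with output `r`, where `none` is
the output `FAIL` and `some y` is the output `y` (the consumed prefix of `x`). There is one
constructor for each way in which a call can return; a call that loops has no output. -/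
inductive Rec (G : PEG T) : ParsingExpr T G.NT → List T → Option (List T) → Prop where
  | eps (x : List T) : Rec G .eps x (some [])
  | fail (x : List T) : Rec G .fail x none
  | terminal (a : T) (z : List T) : Rec G (.terminal a) (a :: z) (some [a])
  | terminal_fail (a : T) (x : List T) (h : ∀ z : List T, x ≠ a :: z) :
      Rec G (.terminal a) x none
  | not_of_fail {e : ParsingExpr T G.NT} {x : List T} :
      Rec G e x none → Rec G (.not e) x (some [])
  | not_of_accept {e : ParsingExpr T G.NT} {x y : List T} :
      Rec G e x (some y) → Rec G (.not e) x none
  | and_of_accept {e : ParsingExpr T G.NT} {x y : List T} :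
      Rec G e x (some y) → Rec G (.and e) x (some [])
  | and_of_fail {e : ParsingExpr T G.NT} {x : List T} :
      Rec G e x none → Rec G (.and e) x none
  | seq {e₁ e₂ : ParsingExpr T G.NT} {y₁ y₂ z : List T} :
      Rec G e₁ (y₁ ++ z) (some y₁) → Rec G e₂ z (some y₂) →
        Rec G (.seq e₁ e₂) (y₁ ++ z) (some (y₁ ++ y₂))
  | seq_fail_left {e₁ e₂ : ParsingExpr T G.NT} {x : List T} :
      Rec G e₁ x none → Rec G (.seq e₁ e₂) x none
  | seq_fail_right {e₁ e₂ : ParsingExpr T G.NT} {y₁ z : List T} :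
      Rec G e₁ (y₁ ++ z) (some y₁) → Rec G e₂ z none →
        Rec G (.seq e₁ e₂) (y₁ ++ z) none
  | choice_left {e₁ e₂ : ParsingExpr T G.NT} {x y : List T} :
      Rec G e₁ x (some y) → Rec G (.choice e₁ e₂) x (some y)
  | choice_right {e₁ e₂ : ParsingExpr T G.NT} {x : List T} {r : Option (List T)} :
      Rec G e₁ x none → Rec G e₂ x r → Rec G (.choice e₁ e₂) x r
  | nonterminal {A : G.NT} {x : List T} {r : Option (List T)} :
      Rec G (G.rule A) x r → Rec G (.nonterminal A) x r

/-- `G` is total if its recognition procedure halts on every expression and every input. -/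
def IsTotal (G : PEG T) : Prop :=
  ∀ (e : ParsingExpr T G.NT) (x : List T), ∃ r : Option (List T), G.Rec e x r

/-- The language recognised by `G`: the words that the starting non-terminal accepts and
consumes entirely. -/
def language (G : PEG T) : Language T :=
  {x | G.Rec (.nonterminal G.start) x (some x)}

end PEG

/-- The class of languages over `T` that are recognised by total parsing expression grammars. -/
def PEGLanguages (T : Type*) : Set (Language T) :=
  {L | ∃ G : PEG T, G.IsTotal ∧ G.language = L}

/-- A `(d, Γ)`-scaffold with nodes `0, …, top`. The edge lists and the labelling are extended
by `none` (which stands for `∅`) to the numbers beyond `top`, which are not nodes. An edge may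
point to the node itself. -/
structure Scaffold (d : ℕ) (Γ : Type*) where
  top : ℕ
  edge : ℕ → Fin d → Option ℕ
  label : ℕ → Option Γ
  edge_le : ∀ v i w, edge v i = some w → w ≤ v
  edge_eq_none : ∀ v i, top < v → edge v i = none
  label_eq_none : ∀ v, top < v → label v = none

/-- The set `𝒩_k(d, Γ) ∪ {∅}`. Here `∅` is a single symbol, so for `k = 0` this is `Γ ∪ {∅}`. -/
def NeighbourhoodOrNone (d : ℕ) (Γ : Type*) : ℕ → Type _
  | 0 => Option Γ
  | k + 1 => Option (Option Γ × (Fin d → NeighbourhoodOrNone d Γ k))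

/-- The set `𝒩_k(d, Γ)` of `k`-neighbourhoods: `𝒩_0(d, Γ) = Γ ∪ {∅}` and
`𝒩_{k+1}(d, Γ) = (Γ ∪ {∅}) × (𝒩_k(d, Γ) ∪ {∅})^d`. -/
def Neighbourhood (d : ℕ) (Γ : Type*) : ℕ → Type _
  | 0 => Option Γ
  | k + 1 => Option Γ × (Fin d → NeighbourhoodOrNone d Γ k)

namespace Scaffold

variable {d : ℕ} {Γ : Type*}

/-- Follow the path `p` from a node (or from `none`), giving `none` once an edge is missing. -/
def follow (S : Scaffold d Γ) (v : Option ℕ) (p : List (Fin d)) : Option ℕ :=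
  p.foldl (fun u i => u.bind fun w => S.edge w i) v

theorem follow_le (S : Scaffold d Γ) (p : List (Fin d)) (v w : ℕ)
    (h : S.follow (some v) p = some w) : w ≤ v := by
  induction p generalizing v with
  | nil => simp [follow] at h; omega
  | cons i p ih =>
    cases hu : S.edge v i with
    | none =>
      have hn : S.follow none p = none := by
        clear h ih
        induction p with
        | nil => rfl
        | cons j p ih => simpa [follow] using ih
      simp [follow, hu] at h
      simp [follow] at hn
      simp [hn] at h
    | some u =>
      have h₁ : S.follow (some u) p = some w := by simpa [follow, hu] using h
      exact (ih u h₁).trans (S.edge_le v i u hu)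

/-- `N_k(S, v)` for a node `v`, and `N_k(S, ∅) = ∅`, as elements of `𝒩_k(d, Γ) ∪ {∅}`. -/
def neighbourhoodOrNone (S : Scaffold d Γ) : (k : ℕ) → Option ℕ → NeighbourhoodOrNone d Γ k
  | 0, none => (none : Option Γ)
  | 0, some v => S.label v
  | _ + 1, none => none
  | k + 1, some v => some (S.label v, fun i => S.neighbourhoodOrNone k (S.edge v i))

/-- The `k`-neighbourhood `N_k(S, v)` of the node `v` in `S`. -/
def neighbourhood (S : Scaffold d Γ) : (k : ℕ) → ℕ → Neighbourhood d Γ k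
  | 0, v => S.label v
  | k + 1, v => (S.label v, fun i => S.neighbourhoodOrNone k (S.edge v i))

/-- The initial scaffold: the single unlabelled node `0`, without edges. -/
def initial (d : ℕ) (Γ : Type*) : Scaffold d Γ where
  top := 0
  edge := fun _ _ => none
  label := fun _ => none
  edge_le := by simp
  edge_eq_none := by simp
  label_eq_none := by simp

end Scaffold

/-- An element of `[d)^{≤ k} ∪ {SELF, ∅}`. -/
inductive EdgeChoice (d k : ℕ) where
  | path (p : List (Fin d)) (hp : p.length ≤ k) : EdgeChoice d k
  | self : EdgeChoice d k
  | missing : EdgeChoice d k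

namespace Scaffold

variable {d k : ℕ} {Γ : Type*}

/-- Where an edge of the new top node `S.top + 1` points. -/
def target (S : Scaffold d Γ) : EdgeChoice d k → Option ℕ
  | .path p _ => S.follow (some S.top) p
  | .self => some (S.top + 1)
  | .missing => none

/-- The scaffold `S` with a new top node, labelled `γ`, with edges given by `p`. -/
def extend (S : Scaffold d Γ) (γ : Γ) (p : Fin d → EdgeChoice d k) : Scaffold d Γ where
  top := S.top + 1
  edge := fun v i => if v = S.top + 1 then S.target (p i) else S.edge v i
  label := fun v => if v = S.top + 1 then some γ else S.label v
  edge_le := by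
    intro v i w h
    split_ifs at h with hv
    · subst hv
      cases hp : p i with
      | path q hq =>
        rw [hp] at h
        exact (S.follow_le q _ _ h).trans (Nat.le_succ _)
      | self =>
        rw [hp] at h
        simp only [target, Option.some.injEq] at h
        exact h.ge
      | missing => simp [hp, target] at h
    · exact S.edge_le v i w h
  edge_eq_none := by
    intro v i h
    rw [if_neg h.ne']
    exact S.edge_eq_none v i (by omega)
  label_eq_none := by
    intro v h
    rw [if_neg h.ne']
    exact S.label_eq_none v (by omega)

end Scaffold

/-- A scaffolding automaton with input alphabet `T`. The working alphabet and the set of states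
are finite types; taking them in `Type` loses no generality. -/
structure ScaffoldingAutomaton (T : Type*) where
  degree : ℕ
  one_le_degree : 1 ≤ degree
  Γ : Type
  finite_Γ : Finite Γ
  distance : ℕ
  Q : Type
  finite_Q : Finite Q
  δ : Q → T → Neighbourhood degree Γ distance → Q × Γ × (Fin degree → EdgeChoice degree distance)
  q₀ : Q
  F : Set Q

namespace ScaffoldingAutomaton

variable {T : Type*}

/-- A single step of computation, reading the symbol `σ`. -/
def step (A : ScaffoldingAutomaton T) (c : A.Q × Scaffold A.degree A.Γ) (σ : T) :
    A.Q × Scaffold A.degree A.Γ :=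
  let r := A.δ c.1 σ (c.2.neighbourhood A.distance c.2.top)
  (r.1, c.2.extend r.2.1 r.2.2)

/-- The last state and scaffold of the computation of `A` on the input `x`, read from its first
symbol to its last. -/
def run (A : ScaffoldingAutomaton T) (x : List T) : A.Q × Scaffold A.degree A.Γ :=
  x.foldl A.step (A.q₀, Scaffold.initial A.degree A.Γ)

/-- The language decided by `A`. -/
def language (A : ScaffoldingAutomaton T) : Language T :=
  {x | (A.run x).1 ∈ A.F}

end ScaffoldingAutomaton

/-! Read from the end, the input `x` gives a scaffold whose node `n` stands for the suffix of `x` of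
length `n`. A backward edge then leads from a suffix to what is left after some prefix is consumed,
which is what an accepting call of a parsing expression yields. Both simulations identify edges with
calls, by induction on the suffix; nodes never change once created, so facts about shorter suffixes
persist (`edge_scaffold_of_suffix`).

From an automaton to a grammar: non-terminals test the state and the label at the current suffix,
and for each edge number one consumes exactly up to the target of that edge. On `a :: z` these data
depend on `a`, the state and the neighbourhood at `z`. Once `a` is consumed, all of this can be
tested by lookahead, and there are finitely many possibilities, so a finite choice suffices
(`simulates`). Every call of a non-terminal within a rule comes after a terminal, hence the grammar
is total (`isTotal_of_guarded`).

From a grammar to an automaton: there is one edge for each expression in a finite set closed under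
recursive calls. A call on `a :: z` recurses on the same input until `a` is consumed; from then on
each further call is an edge already present in the scaffold of `z`, so the result is a path.
Iterating one-step evaluation, the set of expressions with a known result grows strictly until it is
stable, so as many rounds as there are expressions suffice (`eval_size_ne_none`). By totality every
result is then known (`exists_eval_eq_some`). Each round lengthens paths by at most one edge, so a
neighbourhood of bounded depth contains all that is needed. -/

namespace PEG

variable {T : Type*} {G : PEG T}

/-! ### Calls as functions from inputs to remaining inputs -/

theorem Rec.isPrefix {e : ParsingExpr T G.NT} {x : List T} {r : Option (List T)}
    (h : G.Rec e x r) : ∀ y, r = some y → y <+: x := by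
  induction h with
  | seq _ _ _ ih₂ =>
    rintro _ ⟨⟩
    obtain ⟨t, ht⟩ := ih₂ _ rfl
    exact ⟨t, by rw [List.append_assoc, ht]⟩
  | _ => simp_all

/-- The outputs of the subcalls decide which constructor applies; for concatenation, cancelling the
common prefix shows that the second call has the same input. This makes the choice in `out`
harmless. -/
theorem Rec.deterministic {e : ParsingExpr T G.NT} {x : List T} {r s : Option (List T)}
    (h : G.Rec e x r) (h' : G.Rec e x s) : r = s := by
  induction h generalizing s with
  | eps | fail => cases h'; rfl
  | terminal a z =>
    cases h' with
    | terminal => rfl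
    | terminal_fail _ _ h => exact absurd rfl (h z)
  | terminal_fail a x h =>
    cases h' with
    | terminal _ z => exact absurd rfl (h z)
    | terminal_fail => rfl
  | not_of_fail _ ih | not_of_accept _ ih | and_of_fail _ ih | and_of_accept _ ih =>
    cases h' <;> first | rfl | (rename_i h; exact absurd (ih h) (by simp))
  | @seq e₁ e₂ y₁ y₂ z _ _ ih₁ ih₂ =>
    generalize hx : y₁ ++ z = x at h' ih₁
    cases h' with
    | @seq _ _ y₁' y₂' z' h₁ h₂ =>
      obtain rfl : y₁ = y₁' := Option.some.inj (ih₁ h₁)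
      obtain rfl : z = z' := List.append_cancel_left hx
      obtain rfl : y₂ = y₂' := Option.some.inj (ih₂ h₂)
      rfl
    | seq_fail_left h₁ => exact absurd (ih₁ h₁) (by simp)
    | @seq_fail_right _ _ y₁' z' h₁ h₂ =>
      obtain rfl : y₁ = y₁' := Option.some.inj (ih₁ h₁)
      obtain rfl : z = z' := List.append_cancel_left hx
      exact absurd (ih₂ h₂) (by simp)
  | seq_fail_left _ ih =>
    cases h' with
    | seq h₁ h₂ => exact absurd (ih h₁) (by simp)
    | seq_fail_left | seq_fail_right => rfl
  | @seq_fail_right e₁ e₂ y₁ z _ _ ih₁ ih₂ =>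
    generalize hx : y₁ ++ z = x at h' ih₁
    cases h' with
    | @seq _ _ y₁' y₂' z' h₁ h₂ =>
      obtain rfl : y₁ = y₁' := Option.some.inj (ih₁ h₁)
      obtain rfl : z = z' := List.append_cancel_left hx
      exact absurd (ih₂ h₂) (by simp)
    | seq_fail_left h₁ => rfl
    | seq_fail_right => rfl
  | choice_left _ ih =>
    cases h' with
    | choice_left h₁ => exact ih h₁
    | choice_right h₁ _ => exact absurd (ih h₁) (by simp)
  | choice_right _ _ ih₁ ih₂ =>
    cases h' with
    | choice_left h₁ => exact absurd (ih₁ h₁) (by simp)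
    | choice_right _ h₂ => exact ih₂ h₂
  | nonterminal _ ih =>
    cases h' with
    | nonterminal h => exact ih h

open Classical in
/-- The part of the input that is left after a call that accepts; `none` if the call fails
(or loops). -/
noncomputable def out (G : PEG T) (e : ParsingExpr T G.NT) (x : List T) : Option (List T) :=
  if h : ∃ r, G.Rec e x r then h.choose.map fun y => x.drop y.length else none

theorem Rec.out_eq {e : ParsingExpr T G.NT} {x : List T} {r : Option (List T)}
    (h : G.Rec e x r) : G.out e x = r.map fun y => x.drop y.length := by
  have h' : ∃ r, G.Rec e x r := ⟨r, h⟩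
  rw [out, dif_pos h', h.deterministic h'.choose_spec]

theorem suffix_of_out_eq_some {e : ParsingExpr T G.NT} {x z : List T}
    (h : G.out e x = some z) : z <:+ x := by
  unfold out at h
  split at h
  · obtain ⟨y, -, rfl⟩ := Option.map_eq_some_iff.1 h
    exact List.drop_suffix _ _
  · simp at h

theorem out_eps (G : PEG T) (x : List T) : G.out .eps x = some x := by
  simp [(Rec.eps x).out_eq]

theorem out_fail (G : PEG T) (x : List T) : G.out .fail x = none := by
  simp [(Rec.fail x).out_eq]

theorem out_terminal_nil (G : PEG T) (a : T) : G.out (.terminal a) [] = none := by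
  simp [(Rec.terminal_fail a [] (by simp)).out_eq]

theorem out_terminal_cons (G : PEG T) [DecidableEq T] (a b : T) (z : List T) :
    G.out (.terminal a) (b :: z) = if a = b then some z else none := by
  split_ifs with h
  · subst h
    simp [(Rec.terminal a z).out_eq]
  · simp [(Rec.terminal_fail a (b :: z) (by simp [Ne.symm h])).out_eq]


namespace IsTotal

/-- A looping call also has `out` equal to `none`. Totality excludes this, so that `none` means
failure and `out` obeys the compositional equations that follow. -/
theorem out_cases (hG : G.IsTotal) (e : ParsingExpr T G.NT) (x : List T) :
    (G.Rec e x none ∧ G.out e x = none) ∨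
      ∃ y z, x = y ++ z ∧ G.Rec e x (some y) ∧ G.out e x = some z := by
  obtain ⟨r | y, h⟩ := hG e x
  · exact .inl ⟨h, by simp [h.out_eq]⟩
  · obtain ⟨z, rfl⟩ := h.isPrefix y rfl
    exact .inr ⟨y, z, rfl, h, by simp [h.out_eq]⟩

theorem out_not (hG : G.IsTotal) (e : ParsingExpr T G.NT) (x : List T) :
    G.out (.not e) x = if G.out e x = none then some x else none := by
  obtain ⟨h, h'⟩ | ⟨y, z, -, h, h'⟩ := hG.out_cases e x
  · simp [h', (Rec.not_of_fail h).out_eq]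
  · simp [h', (Rec.not_of_accept h).out_eq]

theorem out_and (hG : G.IsTotal) (e : ParsingExpr T G.NT) (x : List T) :
    G.out (.and e) x = if G.out e x = none then none else some x := by
  obtain ⟨h, h'⟩ | ⟨y, z, -, h, h'⟩ := hG.out_cases e x
  · simp [h', (Rec.and_of_fail h).out_eq]
  · simp [h', (Rec.and_of_accept h).out_eq]

theorem out_seq (hG : G.IsTotal) (e₁ e₂ : ParsingExpr T G.NT) (x : List T) :
    G.out (.seq e₁ e₂) x = (G.out e₁ x).bind (G.out e₂) := by
  obtain ⟨h, h'⟩ | ⟨y, z, rfl, h, h'⟩ := hG.out_cases e₁ x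
  · simp [h', (Rec.seq_fail_left h).out_eq]
  · obtain ⟨k, k'⟩ | ⟨y', w, rfl, k, k'⟩ := hG.out_cases e₂ z
    · simp [h', k', (Rec.seq_fail_right h k).out_eq]
    · simp only [h', k', (Rec.seq h k).out_eq, Option.bind_some, Option.map_some]
      rw [← List.append_assoc, List.drop_left]

theorem out_choice (hG : G.IsTotal) (e₁ e₂ : ParsingExpr T G.NT) (x : List T) :
    G.out (.choice e₁ e₂) x = (G.out e₁ x).or (G.out e₂ x) := by
  obtain ⟨h, h'⟩ | ⟨y, z, rfl, h, h'⟩ := hG.out_cases e₁ x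
  · obtain ⟨r, k⟩ := hG e₂ x
    simp [h', k.out_eq, (Rec.choice_right h k).out_eq]
  · simp [h', (Rec.choice_left h).out_eq]

theorem out_nonterminal (hG : G.IsTotal) (A : G.NT) (x : List T) :
    G.out (.nonterminal A) x = G.out (G.rule A) x := by
  obtain ⟨r, h⟩ := hG (G.rule A) x
  rw [h.out_eq, h.nonterminal.out_eq]

theorem mem_language_iff (hG : G.IsTotal) (x : List T) :
    x ∈ G.language ↔ G.out (.nonterminal G.start) x = some [] := by
  constructor
  · intro h
    have h : G.Rec (.nonterminal G.start) x (some x) := h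
    simp [h.out_eq]
  · intro h
    obtain ⟨-, h'⟩ | ⟨y, z, rfl, hr, h'⟩ := hG.out_cases (.nonterminal G.start) x
    · simp [h'] at h
    · obtain rfl : z = [] := by simpa [h'] using h
      rw [List.append_nil] at *
      exact hr

end IsTotal

end PEG

/-! ### Guarded grammars are total -/

namespace ParsingExpr

variable {T N : Type*}

/-- A syntactic condition that ensures that a non-terminal is called only after a terminal has
been consumed. -/
def Guarded : ParsingExpr T N → Prop
  | eps | fail | terminal _ => True
  | nonterminal _ => False
  | not e | and e => Guarded e
  | seq e₁ e₂ => Guarded e₁ ∧ (Guarded e₂ ∨ ∃ a, e₁ = terminal a)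
  | choice e₁ e₂ => Guarded e₁ ∧ Guarded e₂

end ParsingExpr

namespace PEG

variable {T : Type*} {G : PEG T}

theorem exists_rec_not {e : ParsingExpr T G.NT} {x : List T} (h : ∃ r, G.Rec e x r) :
    ∃ r, G.Rec (.not e) x r := by
  obtain ⟨r | y, h⟩ := h
  exacts [⟨_, .not_of_fail h⟩, ⟨_, .not_of_accept h⟩]

theorem exists_rec_and {e : ParsingExpr T G.NT} {x : List T} (h : ∃ r, G.Rec e x r) :
    ∃ r, G.Rec (.and e) x r := by
  obtain ⟨r | y, h⟩ := h
  exacts [⟨_, .and_of_fail h⟩, ⟨_, .and_of_accept h⟩]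

theorem exists_rec_choice {e₁ e₂ : ParsingExpr T G.NT} {x : List T}
    (h₁ : ∃ r, G.Rec e₁ x r) (h₂ : ∃ r, G.Rec e₂ x r) : ∃ r, G.Rec (.choice e₁ e₂) x r := by
  obtain ⟨r | y, h₁⟩ := h₁
  · exact ⟨_, .choice_right h₁ h₂.choose_spec⟩
  · exact ⟨_, .choice_left h₁⟩

theorem exists_rec_seq {e₁ e₂ : ParsingExpr T G.NT} {x : List T} (h₁ : ∃ r, G.Rec e₁ x r)
    (h₂ : ∀ y z, x = y ++ z → G.Rec e₁ x (some y) → ∃ r, G.Rec e₂ z r) :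
    ∃ r, G.Rec (.seq e₁ e₂) x r := by
  obtain ⟨r | y, h₁⟩ := h₁
  · exact ⟨_, .seq_fail_left h₁⟩
  · obtain ⟨z, rfl⟩ := h₁.isPrefix y rfl
    obtain ⟨r | y', h₂⟩ := h₂ y z rfl h₁
    exacts [⟨_, .seq_fail_right h₁ h₂⟩, ⟨_, .seq h₁ h₂⟩]

/-- Strong induction on the length of the input. For a fixed input, guarded expressions halt by
structural induction, since they reach a non-terminal only on a shorter input. Arbitrary expressions
then follow structurally, a non-terminal being replaced by its guarded rule. -/
theorem isTotal_of_guarded (hG : ∀ A, (G.rule A).Guarded) : G.IsTotal := by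
  suffices ∀ (n : ℕ) (x : List T), x.length = n → ∀ e, ∃ r, G.Rec e x r from
    fun e x => this _ x rfl e
  intro n
  induction n using Nat.strong_induction_on with
  | _ n ih =>
  rintro x rfl
  have eps : ∃ r, G.Rec .eps x r := ⟨_, .eps x⟩
  have fail : ∃ r, G.Rec .fail x r := ⟨_, .fail x⟩
  have terminal (a : T) : ∃ r, G.Rec (.terminal a) x r := by
    by_cases h : ∃ z, x = a :: z
    · obtain ⟨z, rfl⟩ := h
      exact ⟨_, .terminal a z⟩
    · exact ⟨_, .terminal_fail a x fun z hz => h ⟨z, hz⟩⟩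
  have seq {e₁ e₂ : ParsingExpr T G.NT} (h₁ : ∃ r, G.Rec e₁ x r)
      (h₂ : G.Rec e₁ x (some []) → ∃ r, G.Rec e₂ x r) : ∃ r, G.Rec (.seq e₁ e₂) x r := by
    refine exists_rec_seq h₁ ?_
    rintro (_ | ⟨a, y⟩) z rfl h
    · exact h₂ h
    · exact ih z.length (by simp) z rfl e₂
  have guarded (e : ParsingExpr T G.NT) (he : e.Guarded) : ∃ r, G.Rec e x r := by
    induction e with
    | eps => exact eps
    | fail => exact fail
    | terminal a => exact terminal a
    | nonterminal A => exact he.elim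
    | not e ih => exact exists_rec_not (ih he)
    | and e ih => exact exists_rec_and (ih he)
    | seq e₁ e₂ ih₁ ih₂ =>
      refine seq (ih₁ he.1) fun h => ?_
      obtain h₂ | ⟨a, rfl⟩ := he.2
      · exact ih₂ h₂
      -- A terminal never accepts with the empty prefix.
      · cases h
    | choice e₁ e₂ ih₁ ih₂ => exact exists_rec_choice (ih₁ he.1) (ih₂ he.2)
  intro e
  induction e with
  | eps => exact eps
  | fail => exact fail
  | terminal a => exact terminal a
  | nonterminal A =>
    obtain ⟨r, h⟩ := guarded _ (hG A)
    exact ⟨r, h.nonterminal⟩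
  | not e ih => exact exists_rec_not ih
  | and e ih => exact exists_rec_and ih
  | seq e₁ e₂ ih₁ ih₂ => exact seq ih₁ fun _ => ih₂
  | choice e₁ e₂ ih₁ ih₂ => exact exists_rec_choice ih₁ ih₂

end PEG

/-! ### Finite choices and conjunctions of expressions -/

/-- A list of the elements of a finite type. -/
noncomputable def elementList (α : Type*) [Finite α] : List α :=
  (Fintype.ofFinite α).elems.toList

theorem mem_elementList {α : Type*} [Finite α] (a : α) : a ∈ elementList α :=
  Finset.mem_toList.2 ((Fintype.ofFinite α).complete a)

namespace ParsingExpr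

variable {T N ι : Type*}

/-- The prioritised choice between the expressions `f i`, for `i` in the list `l`. -/
def choices (l : List ι) (f : ι → ParsingExpr T N) : ParsingExpr T N :=
  l.foldr (fun i e => .choice (f i) e) .fail

/-- The expression that tests whether all expressions in the list `l` accept. -/
def allOf (l : List (ParsingExpr T N)) : ParsingExpr T N :=
  l.foldr (fun e e' => .seq (.and e) e') .eps

theorem guarded_choices (l : List ι) {f : ι → ParsingExpr T N} (h : ∀ i, (f i).Guarded) :
    (choices l f).Guarded := by
  induction l with
  | nil => trivial
  | cons i l ih => exact ⟨h i, ih⟩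

end ParsingExpr

namespace PEG.IsTotal

open ParsingExpr

variable {T ι : Type*} {G : PEG T}

theorem isSome_out_choices (hG : G.IsTotal) (l : List ι) (f : ι → ParsingExpr T G.NT)
    (x : List T) : (G.out (choices l f) x).isSome ↔ ∃ i ∈ l, (G.out (f i) x).isSome := by
  induction l with
  | nil => simp [choices, PEG.out_fail]
  | cons i l ih =>
    have : choices (i :: l) f = .choice (f i) (choices l f) := rfl
    simp [this, hG.out_choice, ih]

theorem out_choices_eq_none (hG : G.IsTotal) {l : List ι} {f : ι → ParsingExpr T G.NT}
    {x : List T} (h : ∀ i ∈ l, G.out (f i) x = none) : G.out (choices l f) x = none := by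
  rw [← Option.not_isSome_iff_eq_none, hG.isSome_out_choices]
  rintro ⟨i, hi, hs⟩
  simp [h i hi] at hs

/-- When all other alternatives fail, priority is irrelevant, so the order of `elementList` does not
matter. -/
theorem out_choices_eq (hG : G.IsTotal) {l : List ι} {f : ι → ParsingExpr T G.NT}
    {x : List T} {i : ι} (hi : i ∈ l) (h : ∀ j ∈ l, j ≠ i → G.out (f j) x = none) :
    G.out (choices l f) x = G.out (f i) x := by
  induction l with
  | nil => simp at hi
  | cons j l ih =>
    have hc : choices (j :: l) f = .choice (f j) (choices l f) := rfl
    rw [hc, hG.out_choice]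
    by_cases hl : i ∈ l
    · rw [ih hl fun j hj => h j (List.mem_cons_of_mem _ hj)]
      by_cases hj : j = i
      · simp [hj]
      · simp [h j List.mem_cons_self hj]
    · obtain rfl : i = j := by simpa [hl] using hi
      rw [hG.out_choices_eq_none (l := l) fun j hj =>
        h j (List.mem_cons_of_mem _ hj) (fun e => hl (e ▸ hj))]
      simp

theorem isSome_out_allOf (hG : G.IsTotal) (l : List (ParsingExpr T G.NT)) (x : List T) :
    (G.out (allOf l) x).isSome ↔ ∀ e ∈ l, (G.out e x).isSome := by
  induction l with
  | nil => simp [allOf, out_eps]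
  | cons e l ih =>
    have : allOf (e :: l) = .seq (.and e) (allOf l) := rfl
    rw [this, hG.out_seq, hG.out_and, List.forall_mem_cons, ← ih]
    cases h : G.out e x <;> simp

theorem isSome_out_choices_terminal (hG : G.IsTotal) [Finite T] (x : List T) :
    (G.out (choices (elementList T) .terminal) x).isSome ↔ x ≠ [] := by
  classical
  rw [hG.isSome_out_choices]
  cases x with
  | nil => simp [out_terminal_nil]
  | cons a x => simpa using ⟨a, mem_elementList a, by simp [out_terminal_cons]⟩

end PEG.IsTotal

/-! ### Finiteness of neighbourhoods -/

theorem finite_neighbourhoodOrNone (d : ℕ) (Γ : Type*) [Finite Γ] (k : ℕ) :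
    Finite (NeighbourhoodOrNone d Γ k) := by
  induction k with
  | zero => exact inferInstanceAs (Finite (Option Γ))
  | succ k ih => exact inferInstanceAs (Finite (Option (Option Γ × (Fin d → _))))

theorem finite_neighbourhood (d : ℕ) (Γ : Type*) [Finite Γ] (k : ℕ) :
    Finite (Neighbourhood d Γ k) := by
  cases k with
  | zero => exact inferInstanceAs (Finite (Option Γ))
  | succ k =>
    have := finite_neighbourhoodOrNone d Γ k
    exact inferInstanceAs (Finite (Option Γ × (Fin d → NeighbourhoodOrNone d Γ k)))

/-- The inclusion of `𝒩_k(d, Γ)` in `𝒩_k(d, Γ) ∪ {∅}`. -/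
def Neighbourhood.toOrNone {d : ℕ} {Γ : Type*} :
    (k : ℕ) → Neighbourhood d Γ k → NeighbourhoodOrNone d Γ k
  | 0, N => N
  | _ + 1, N => some N

theorem Neighbourhood.toOrNone_injective {d : ℕ} {Γ : Type*} (k : ℕ) :
    Function.Injective (toOrNone (d := d) (Γ := Γ) k) := by
  cases k with
  | zero => exact fun _ _ h => h
  | succ k => exact fun _ _ h => Option.some.inj h

theorem Scaffold.neighbourhoodOrNone_some {d : ℕ} {Γ : Type*} (S : Scaffold d Γ) (k v : ℕ) :
    S.neighbourhoodOrNone k (some v) = (S.neighbourhood k v).toOrNone k := by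
  cases k <;> rfl

namespace Scaffold

variable {d k : ℕ} {Γ : Type*}

theorem follow_none (S : Scaffold d Γ) (p : List (Fin d)) : S.follow none p = none := by
  induction p with
  | nil => rfl
  | cons i p ih => exact ih

theorem follow_some_cons (S : Scaffold d Γ) (v : ℕ) (i : Fin d) (p : List (Fin d)) :
    S.follow (some v) (i :: p) = S.follow (S.edge v i) p := rfl

end Scaffold

/-! ### From a scaffolding automaton to a total grammar -/

namespace ScaffoldingAutomaton

variable {T : Type*} (A : ScaffoldingAutomaton T)

/-- The arguments of the transition function. -/
abbrev Situation : Type _ := A.Q × T × Neighbourhood A.degree A.Γ A.distance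

instance [Finite T] : Finite A.Situation :=
  have := A.finite_Q
  have := A.finite_Γ
  have := finite_neighbourhood A.degree A.Γ A.distance
  inferInstance

/-- The scaffold after the automaton has read `z` from its last symbol to its first. -/
def scaffold (z : List T) : Scaffold A.degree A.Γ := (A.run z.reverse).2

/-- The state after the automaton has read `z` from its last symbol to its first. -/
def state (z : List T) : A.Q := (A.run z.reverse).1

/-- The arguments of the transition function when `a` is read after `z`. -/
def situation (z : List T) (a : T) : A.Situation :=
  (A.state z, a, (A.scaffold z).neighbourhood A.distance (A.scaffold z).top)

/-- The value of the transition function. -/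
def move (s : A.Situation) : A.Q × A.Γ × (Fin A.degree → EdgeChoice A.degree A.distance) :=
  A.δ s.1 s.2.1 s.2.2

theorem run_cons (z : List T) (a : T) :
    A.run (a :: z).reverse = A.step (A.run z.reverse) a := by
  simp [run]

theorem state_cons (z : List T) (a : T) :
    A.state (a :: z) = (A.move (A.situation z a)).1 := by
  simp only [state, run_cons]; rfl

theorem scaffold_cons (z : List T) (a : T) :
    A.scaffold (a :: z) = (A.scaffold z).extend (A.move (A.situation z a)).2.1
      (A.move (A.situation z a)).2.2 := by
  simp only [scaffold, run_cons]; rfl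

theorem state_nil : A.state [] = A.q₀ := rfl

theorem scaffold_nil : A.scaffold [] = Scaffold.initial A.degree A.Γ := rfl

theorem top_scaffold (z : List T) : (A.scaffold z).top = z.length := by
  induction z with
  | nil => rfl
  | cons a z ih => rw [scaffold_cons, List.length_cons, ← ih]; rfl

theorem edge_scaffold_cons (z : List T) (a : T) (i : Fin A.degree) :
    (A.scaffold (a :: z)).edge (a :: z).length i =
      (A.scaffold z).target ((A.move (A.situation z a)).2.2 i) := by
  simp [scaffold_cons, Scaffold.extend, top_scaffold]

theorem label_scaffold_cons (z : List T) (a : T) :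
    (A.scaffold (a :: z)).label (a :: z).length = some (A.move (A.situation z a)).2.1 := by
  simp [scaffold_cons, Scaffold.extend, top_scaffold]

/-- Reading a symbol only adds a node. What is known about the top node of the scaffold of `w`
therefore remains true of the same node in every later scaffold. -/
theorem edge_scaffold_of_suffix {w z : List T} (h : w <:+ z) (i : Fin A.degree) :
    (A.scaffold z).edge w.length i = (A.scaffold w).edge w.length i := by
  induction z with
  | nil => rw [List.suffix_nil.1 h]
  | cons a z ih =>
    obtain rfl | h := List.suffix_cons_iff.1 h
    · rfl
    · rw [← ih h, scaffold_cons]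
      exact if_neg (by rw [top_scaffold]; have := h.length_le; omega)

theorem label_scaffold_of_suffix {w z : List T} (h : w <:+ z) :
    (A.scaffold z).label w.length = (A.scaffold w).label w.length := by
  induction z with
  | nil => rw [List.suffix_nil.1 h]
  | cons a z ih =>
    obtain rfl | h := List.suffix_cons_iff.1 h
    · rfl
    · rw [← ih h, scaffold_cons]
      exact if_neg (by rw [top_scaffold]; have := h.length_le; omega)

/-- The non-terminals of a grammar that simulates a scaffolding automaton. -/
inductive NonTerminal (Q Γ : Type) (d : ℕ) : Type where
  | state (q : Q)
  | label (g : Option Γ)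
  | edge (i : Fin d)
  | all
  | start

theorem NonTerminal.finite (Q Γ : Type) (d : ℕ) [Finite Q] [Finite Γ] :
    Finite (NonTerminal Q Γ d) := by
  let f : (Q ⊕ Option Γ) ⊕ (Fin d ⊕ Bool) → NonTerminal Q Γ d
    | .inl (.inl q) => .state q
    | .inl (.inr g) => .label g
    | .inr (.inl i) => .edge i
    | .inr (.inr true) => .all
    | .inr (.inr false) => .start
  refine Finite.of_surjective f ?_
  rintro (q | g | i | _ | _)
  exacts [⟨.inl (.inl q), rfl⟩, ⟨.inl (.inr g), rfl⟩, ⟨.inr (.inl i), rfl⟩,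
    ⟨.inr (.inr true), rfl⟩, ⟨.inr (.inr false), rfl⟩]

/-- The expressions of the grammar that simulates `A`. -/
abbrev Expr : Type _ := ParsingExpr T (NonTerminal A.Q A.Γ A.degree)

open ParsingExpr

/-- Test whether the result of following `e` has the neighbourhood `N`. -/
noncomputable def testExpr : (k : ℕ) → A.Expr → NeighbourhoodOrNone A.degree A.Γ k → A.Expr
  -- At depth 0 a missing node and an unlabelled node have the same neighbourhood, so both
  -- possibilities are tested.
  | 0, e, none => .choice (.not e) (.seq e (.nonterminal (.label none)))
  | 0, e, some γ => .seq e (.nonterminal (.label (some γ)))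
  | _ + 1, e, none => .not e
  | k + 1, e, some N => .seq e (allOf (.nonterminal (.label N.1) ::
      (elementList (Fin A.degree)).map fun i => testExpr k (.nonterminal (.edge i)) (N.2 i)))

/-- Consume a symbol, and test whether `s` is the situation in which `A` reads it. -/
noncomputable def situationExpr (s : A.Situation) : A.Expr :=
  .seq (.terminal s.2.1) (allOf [.nonterminal (.state s.1),
    A.testExpr A.distance .eps (s.2.2.toOrNone A.distance)])

/-- Follow a path. -/
def pathExpr (p : List (Fin A.degree)) : A.Expr :=
  p.foldr (fun i e => .seq (.nonterminal (.edge i)) e) .eps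

/-- Follow an edge that was created as `c` when the symbol `a` was read. -/
def edgeExpr (a : T) : EdgeChoice A.degree A.distance → A.Expr
  | .path p _ => .seq (.terminal a) (A.pathExpr p)
  | .self => .eps
  | .missing => .fail

theorem guarded_situationExpr (s : A.Situation) : (A.situationExpr s).Guarded :=
  ⟨trivial, .inr ⟨_, rfl⟩⟩

variable [Finite T]

open Classical in
/-- Test whether the state is `q`. -/
noncomputable def stateRule (q : A.Q) : A.Expr :=
  .choice (if q = A.q₀ then .not (choices (elementList T) .terminal) else .fail)
    (choices (elementList A.Situation) fun s =>
      if (A.move s).1 = q then A.situationExpr s else .fail)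

open Classical in
/-- Test whether the label of the top node is `g`. -/
noncomputable def labelRule : Option A.Γ → A.Expr
  -- Only node 0 is unlabelled, and it stands for the empty suffix.
  | none => .not (choices (elementList T) .terminal)
  | some γ => choices (elementList A.Situation) fun s =>
      if (A.move s).2.1 = γ then A.situationExpr s else .fail

/-- Follow an edge of the top node. -/
noncomputable def edgeRule (i : Fin A.degree) : A.Expr :=
  choices (elementList A.Situation) fun s =>
    -- Lookahead restores `a`, which a self-loop must not consume.
    .seq (.and (A.situationExpr s)) (A.edgeExpr s.2.1 ((A.move s).2.2 i))

/-- Consume the whole input. -/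
noncomputable def allRule : A.Expr :=
  .choice (choices (elementList T) fun a => .seq (.terminal a) (.nonterminal .all)) .eps

open Classical in
/-- Consume the whole input if the state is accepting. -/
noncomputable def startRule : A.Expr :=
  have := A.finite_Q
  choices (elementList A.Q) fun q =>
    -- The rules are inlined, because calls of the corresponding non-terminals would not be guarded
    -- here.
    if q ∈ A.F then .seq (.and (A.stateRule q)) A.allRule else .fail

/-- The rules of the grammar that simulates `A`. -/
noncomputable def rule : NonTerminal A.Q A.Γ A.degree → A.Expr
  | .state q => A.stateRule q
  | .label g => A.labelRule g
  | .edge i => A.edgeRule i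
  | .all => A.allRule
  | .start => A.startRule

/-- A grammar that simulates `A` on the reverse of its input. -/
noncomputable abbrev toPEG : PEG T where
  NT := NonTerminal A.Q A.Γ A.degree
  finite_NT :=
    have := A.finite_Q
    have := A.finite_Γ
    NonTerminal.finite _ _ _
  rule := A.rule
  start := .start

theorem guarded_stateRule (q : A.Q) : (A.stateRule q).Guarded := by
  refine ⟨?_, guarded_choices _ fun s => ?_⟩
  · split_ifs
    exacts [guarded_choices _ fun _ => trivial, trivial]
  · split_ifs
    exacts [A.guarded_situationExpr s, trivial]

theorem guarded_allRule : A.allRule.Guarded :=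
  ⟨guarded_choices _ fun _ => ⟨trivial, .inr ⟨_, rfl⟩⟩, trivial⟩

theorem isTotal_toPEG : A.toPEG.IsTotal := by
  refine PEG.isTotal_of_guarded ?_
  rintro (q | (_ | γ) | i | _ | _)
  · exact A.guarded_stateRule q
  · exact guarded_choices _ fun _ => trivial
  · refine guarded_choices _ fun s => ?_
    split_ifs
    exacts [A.guarded_situationExpr s, trivial]
  · refine guarded_choices _ fun s => ⟨A.guarded_situationExpr s, .inl ?_⟩
    cases (A.move s).2.2 i
    exacts [⟨trivial, .inr ⟨_, rfl⟩⟩, trivial, trivial]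
  · exact A.guarded_allRule
  · refine guarded_choices _ fun q => ?_
    split_ifs
    exacts [⟨A.guarded_stateRule q, .inl A.guarded_allRule⟩, trivial]

/-- The non-terminals describe the top node correctly on the input `z`. -/
structure Simulates (z : List T) : Prop where
  state (q : A.Q) : (A.toPEG.out (.nonterminal (.state q)) z).isSome ↔ A.state z = q
  label (g : Option A.Γ) :
    (A.toPEG.out (.nonterminal (.label g)) z).isSome ↔ (A.scaffold z).label z.length = g
  edge (i : Fin A.degree) : (A.toPEG.out (.nonterminal (.edge i)) z).map List.length =
    (A.scaffold z).edge z.length i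

variable {A}

/-- Induction on the depth: testing the children of a node means calling the edge non-terminals at
that node. The hypothesis on all suffixes is needed since the tests move along edges, while the
neighbourhood is always taken in the scaffold of `z`. -/
theorem isSome_out_testExpr {z : List T} (hz : ∀ w, w <:+ z → A.Simulates w) (k : ℕ)
    (e : A.Expr) (N : NeighbourhoodOrNone A.degree A.Γ k) {w : List T} (hw : w <:+ z) :
    (A.toPEG.out (A.testExpr k e N) w).isSome ↔
      (A.scaffold z).neighbourhoodOrNone k ((A.toPEG.out e w).map List.length) = N := by
  have hG := A.isTotal_toPEG
  have suf {w r : List T} {e : A.Expr} (hw : w <:+ z) (h : A.toPEG.out e w = some r) : r <:+ z :=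
    (PEG.suffix_of_out_eq_some h).trans hw
  induction k generalizing e w with
  | zero =>
    cases h : A.toPEG.out e w with
    | none =>
      cases N with
      | none =>
        simp [testExpr, hG.out_choice, hG.out_not, h, Scaffold.neighbourhoodOrNone]
        rfl
      | some γ => simp [testExpr, hG.out_seq, h, Scaffold.neighbourhoodOrNone]
    | some r =>
      have hr := (hz r (suf hw h)).label
      rw [← A.label_scaffold_of_suffix (suf hw h)] at hr
      cases N with
      | none =>
        simp [testExpr, hG.out_choice, hG.out_not, hG.out_seq, h, Scaffold.neighbourhoodOrNone, hr]
        rfl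
      | some γ =>
        simp [testExpr, hG.out_seq, h, Scaffold.neighbourhoodOrNone, hr]
        rfl
  | succ k ih =>
    cases h : A.toPEG.out e w with
    | none =>
      cases N with
      | none =>
        simp [testExpr, hG.out_not, h, Scaffold.neighbourhoodOrNone]
        rfl
      | some N => simp [testExpr, hG.out_seq, h, Scaffold.neighbourhoodOrNone]
    | some r =>
      cases N with
      | none => simp [testExpr, hG.out_not, h, Scaffold.neighbourhoodOrNone]
      | some N =>
        have hr := (hz r (suf hw h)).label
        rw [← A.label_scaffold_of_suffix (suf hw h)] at hr
        have key (i : Fin A.degree) :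
            (A.toPEG.out (A.testExpr k (.nonterminal (.edge i)) (N.2 i)) r).isSome ↔
              (A.scaffold z).neighbourhoodOrNone k ((A.scaffold z).edge r.length i) = N.2 i := by
          refine (ih _ _ (suf hw h)).trans ?_
          rw [(hz r (suf hw h)).edge i, A.edge_scaffold_of_suffix (suf hw h)]
        obtain ⟨g, N⟩ := N
        simp only [testExpr, hG.out_seq, h, Option.bind_some, hG.isSome_out_allOf,
          List.forall_mem_cons, hr, List.forall_mem_map, key, Option.map_some,
          Scaffold.neighbourhoodOrNone, mem_elementList, true_imp_iff]
        constructor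
        · rintro ⟨h₁, h₂⟩
          exact congrArg some (Prod.ext h₁ (funext h₂))
        · intro h'
          have h' := Option.some.inj h'
          exact ⟨congrArg Prod.fst h', congrFun (congrArg Prod.snd h')⟩

theorem out_situationExpr_nil (s : A.Situation) : A.toPEG.out (A.situationExpr s) [] = none := by
  simp [situationExpr, A.isTotal_toPEG.out_seq, PEG.out_terminal_nil A.toPEG]

theorem isSome_out_situationExpr_cons {z : List T} (hz : ∀ w, w <:+ z → A.Simulates w)
    (s : A.Situation) (a : T) :
    (A.toPEG.out (A.situationExpr s) (a :: z)).isSome ↔ s = A.situation z a := by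
  classical
  have hG := A.isTotal_toPEG
  obtain ⟨q, b, N⟩ := s
  rw [situationExpr, hG.out_seq, PEG.out_terminal_cons A.toPEG]
  dsimp only
  split_ifs with hb
  · subst hb
    rw [Option.bind_some, hG.isSome_out_allOf]
    simp only [List.forall_mem_cons, isSome_out_testExpr hz A.distance .eps _ List.suffix_rfl,
      (hz z List.suffix_rfl).state, PEG.out_eps A.toPEG, Option.map_some,
      Scaffold.neighbourhoodOrNone_some, (Neighbourhood.toOrNone_injective _).eq_iff, situation,
      Prod.mk.injEq, top_scaffold]
    simp only [List.not_mem_nil, false_imp_iff, implies_true, and_true, true_and]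
    exact and_congr eq_comm eq_comm
  · simp [situation, hb]

theorem out_pathExpr {z : List T} (hz : ∀ w, w <:+ z → A.Simulates w)
    (p : List (Fin A.degree)) {w : List T} (hw : w <:+ z) :
    (A.toPEG.out (A.pathExpr p) w).map List.length = (A.scaffold z).follow (some w.length) p := by
  induction p generalizing w with
  | nil => simp [pathExpr, PEG.out_eps A.toPEG, Scaffold.follow]
  | cons i p ih =>
    have hp : A.pathExpr (i :: p) = .seq (.nonterminal (.edge i)) (A.pathExpr p) := rfl
    rw [hp, A.isTotal_toPEG.out_seq, Scaffold.follow_some_cons, A.edge_scaffold_of_suffix hw,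
      ← (hz w hw).edge i]
    cases h : A.toPEG.out (.nonterminal (.edge i)) w with
    | none => simp [Scaffold.follow_none]
    | some r => exact ih ((PEG.suffix_of_out_eq_some h).trans hw)

theorem simulates_nil : A.Simulates ([] : List T) := by
  have hG := A.isTotal_toPEG
  have eof : A.toPEG.out (choices (elementList T) .terminal) [] = none :=
    hG.out_choices_eq_none fun a _ => PEG.out_terminal_nil _ a
  refine ⟨fun q => ?_, fun g => ?_, fun i => ?_⟩ <;> rw [hG.out_nonterminal]
  · change (A.toPEG.out (A.stateRule q) []).isSome ↔ _
    rw [stateRule, hG.out_choice, hG.out_choices_eq_none, state_nil]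
    · split_ifs with h
      · simp [hG.out_not, eof, h]
      · simp [PEG.out_fail A.toPEG, Ne.symm h]
    · intro s _
      split_ifs
      exacts [out_situationExpr_nil s, PEG.out_fail _ _]
  · change (A.toPEG.out (A.labelRule g) []).isSome ↔ _
    cases g with
    | none => simp [labelRule, hG.out_not, eof, scaffold_nil, Scaffold.initial]
    | some γ =>
      rw [labelRule, hG.out_choices_eq_none]
      · simp [scaffold_nil, Scaffold.initial]
      · intro s _
        split_ifs
        exacts [out_situationExpr_nil s, PEG.out_fail _ _]
  · change (A.toPEG.out (A.edgeRule i) []).map _ = _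
    rw [edgeRule, hG.out_choices_eq_none]
    · rfl
    · intro s _
      simp [hG.out_seq, hG.out_and, out_situationExpr_nil]

/-- Exactly one situation passes its test on `a :: z`, so each choice over situations behaves like
its alternative for the actual one. -/
theorem simulates_cons {z : List T} (hz : ∀ w, w <:+ z → A.Simulates w) (a : T) :
    A.Simulates (a :: z) := by
  classical
  have hG := A.isTotal_toPEG
  have eof : A.toPEG.out (.not (choices (elementList T) .terminal)) (a :: z) = none := by
    have := (hG.isSome_out_choices_terminal (a :: z)).2 (by simp)
    rw [hG.out_not, if_neg (by simpa [Option.isSome_iff_ne_none] using this)]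
  have test (P : A.Situation → Prop) [DecidablePred P] :
      (A.toPEG.out (choices (elementList A.Situation) fun s =>
        if P s then A.situationExpr s else .fail) (a :: z)).isSome ↔ P (A.situation z a) := by
    rw [hG.isSome_out_choices]
    constructor
    · rintro ⟨s, -, h⟩
      split_ifs at h with hs
      · rwa [← (isSome_out_situationExpr_cons hz s a).1 h]
      · simp [PEG.out_fail A.toPEG] at h
    · intro h
      exact ⟨_, mem_elementList _, by
        rw [if_pos h]; exact (isSome_out_situationExpr_cons hz _ a).2 rfl⟩
  refine ⟨fun q => ?_, fun g => ?_, fun i => ?_⟩ <;> rw [hG.out_nonterminal]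
  · change (A.toPEG.out (A.stateRule q) (a :: z)).isSome ↔ _
    have : A.toPEG.out (if q = A.q₀ then .not (choices (elementList T) .terminal) else .fail)
        (a :: z) = none := by
      split_ifs
      exacts [eof, PEG.out_fail _ _]
    rw [stateRule, hG.out_choice, this, Option.none_or, state_cons]
    exact test fun s => (A.move s).1 = q
  · change (A.toPEG.out (A.labelRule g) (a :: z)).isSome ↔ _
    rw [label_scaffold_cons]
    cases g with
    | none => simp [labelRule, eof]
    | some γ =>
      rw [Option.some.injEq]
      exact test fun s => (A.move s).2.1 = γ
  · change (A.toPEG.out (A.edgeRule i) (a :: z)).map _ = _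
    rw [edge_scaffold_cons, edgeRule, hG.out_choices_eq (mem_elementList (A.situation z a))]
    · obtain ⟨w, hw⟩ := Option.isSome_iff_exists.1
        ((isSome_out_situationExpr_cons hz (A.situation z a) a).2 rfl)
      rw [hG.out_seq, hG.out_and, hw, if_neg (by simp), Option.bind_some]
      change (A.toPEG.out (A.edgeExpr a _) _).map _ = _
      cases (A.move (A.situation z a)).2.2 i with
      | path p hp =>
        rw [edgeExpr, hG.out_seq, PEG.out_terminal_cons A.toPEG, if_pos rfl, Option.bind_some,
          out_pathExpr hz p List.suffix_rfl, Scaffold.target, top_scaffold]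
      | self => simp [edgeExpr, PEG.out_eps A.toPEG, Scaffold.target, top_scaffold]
      | missing => simp [edgeExpr, PEG.out_fail A.toPEG, Scaffold.target]
    · intro s _ hs
      rw [Ne, ← isSome_out_situationExpr_cons hz s a, Option.not_isSome_iff_eq_none] at hs
      simp [hG.out_seq, hG.out_and, hs]

theorem simulates (z : List T) : A.Simulates z := by
  suffices ∀ w, w <:+ z → A.Simulates w from this z List.suffix_rfl
  induction z with
  | nil =>
    intro w hw
    rw [List.suffix_nil.1 hw]
    exact simulates_nil
  | cons a z ih =>
    intro w hw
    obtain rfl | hw := List.suffix_cons_iff.1 hw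
    exacts [simulates_cons ih a, ih w hw]

theorem out_allRule (z : List T) : A.toPEG.out A.allRule z = some [] := by
  classical
  have hG := A.isTotal_toPEG
  induction z with
  | nil =>
    rw [allRule, hG.out_choice, hG.out_choices_eq_none]
    · simp [PEG.out_eps A.toPEG]
    · intro a _
      simp [hG.out_seq, PEG.out_terminal_nil A.toPEG]
  | cons a z ih =>
    rw [allRule, hG.out_choice, hG.out_choices_eq (mem_elementList a), hG.out_seq,
      PEG.out_terminal_cons A.toPEG, if_pos rfl, Option.bind_some, hG.out_nonterminal]
    · change (A.toPEG.out A.allRule z).or _ = _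
      simp [ih]
    · intro b _ hb
      simp [hG.out_seq, PEG.out_terminal_cons A.toPEG, hb]

theorem isSome_out_stateRule (q : A.Q) (z : List T) :
    (A.toPEG.out (A.stateRule q) z).isSome ↔ A.state z = q := by
  rw [← (simulates z).state q, A.isTotal_toPEG.out_nonterminal]
  rfl

theorem mem_language_toPEG (z : List T) : z ∈ A.toPEG.language ↔ A.state z ∈ A.F := by
  have hG := A.isTotal_toPEG
  have := A.finite_Q
  rw [hG.mem_language_iff, hG.out_nonterminal]
  change A.toPEG.out A.startRule z = _ ↔ _
  rw [startRule, hG.out_choices_eq (mem_elementList (A.state z))]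
  · split_ifs with h
    · obtain ⟨w, hw⟩ := Option.isSome_iff_exists.1 ((isSome_out_stateRule (A.state z) z).2 rfl)
      simp [hG.out_seq, hG.out_and, hw, out_allRule, h]
    · simp [PEG.out_fail A.toPEG, h]
  · intro q _ hq
    split_ifs
    · have := (isSome_out_stateRule q z).not.2 hq.symm
      rw [Option.not_isSome_iff_eq_none] at this
      simp [hG.out_seq, hG.out_and, this]
    · exact PEG.out_fail _ _

end ScaffoldingAutomaton

/-! ### From a grammar to an automaton: finite closed sets of expressions -/

namespace ParsingExpr

variable {T N : Type*}

/-- The set of subexpressions of a parsing expression. -/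
def subexprs : ParsingExpr T N → Set (ParsingExpr T N)
  | eps => {eps}
  | fail => {fail}
  | terminal a => {terminal a}
  | nonterminal A => {nonterminal A}
  | not e => insert (not e) (subexprs e)
  | and e => insert (and e) (subexprs e)
  | seq e₁ e₂ => insert (seq e₁ e₂) (subexprs e₁ ∪ subexprs e₂)
  | choice e₁ e₂ => insert (choice e₁ e₂) (subexprs e₁ ∪ subexprs e₂)

theorem mem_subexprs_self (e : ParsingExpr T N) : e ∈ subexprs e := by
  cases e <;> simp [subexprs]

theorem finite_subexprs (e : ParsingExpr T N) : (subexprs e).Finite := by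
  induction e <;> simp_all [subexprs]

theorem subexprs_subset {e e' : ParsingExpr T N} (h : e' ∈ subexprs e) :
    subexprs e' ⊆ subexprs e := by
  induction e with
  | eps | fail | terminal | nonterminal => rw [Set.mem_singleton_iff.1 h]
  | not e ih | and e ih =>
    obtain rfl | h := h
    · exact subset_rfl
    · exact (ih h).trans (Set.subset_insert _ _)
  | seq e₁ e₂ ih₁ ih₂ | choice e₁ e₂ ih₁ ih₂ =>
    obtain rfl | h | h := h
    · exact subset_rfl
    · exact (ih₁ h).trans (Set.subset_union_left.trans (Set.subset_insert _ _))
    · exact (ih₂ h).trans (Set.subset_union_right.trans (Set.subset_insert _ _))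

end ParsingExpr

namespace PEG

open ParsingExpr

variable {T : Type*}

/-- A set of expressions that contains all expressions on which the recognition procedure calls
itself, directly, when it is called on an element of the set. -/
structure IsClosed (G : PEG T) (E : Set (ParsingExpr T G.NT)) : Prop where
  nonterminal {A : G.NT} : .nonterminal A ∈ E → G.rule A ∈ E
  not {e : ParsingExpr T G.NT} : .not e ∈ E → e ∈ E
  and {e : ParsingExpr T G.NT} : .and e ∈ E → e ∈ E
  seq_left {e₁ e₂ : ParsingExpr T G.NT} : .seq e₁ e₂ ∈ E → e₁ ∈ E
  seq_right {e₁ e₂ : ParsingExpr T G.NT} : .seq e₁ e₂ ∈ E → e₂ ∈ E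
  choice_left {e₁ e₂ : ParsingExpr T G.NT} : .choice e₁ e₂ ∈ E → e₁ ∈ E
  choice_right {e₁ e₂ : ParsingExpr T G.NT} : .choice e₁ e₂ ∈ E → e₂ ∈ E

/-- An enumeration of a finite closed set of expressions that contains the starting
non-terminal. -/
structure Indexing (G : PEG T) where
  size : ℕ
  expr : Fin size → ParsingExpr T G.NT
  index : ParsingExpr T G.NT → Fin size
  expr_index : ∀ e ∈ Set.range expr, expr (index e) = e
  closed : G.IsClosed (Set.range expr)
  start_mem : .nonterminal G.start ∈ Set.range expr

theorem exists_finite_isClosed (G : PEG T) :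
    ∃ E : Set (ParsingExpr T G.NT), E.Finite ∧ G.IsClosed E ∧ .nonterminal G.start ∈ E := by
  have := G.finite_NT
  refine ⟨{.nonterminal G.start} ∪ ⋃ A, subexprs (G.rule A), ?_, ?_, by simp⟩
  · exact (Set.finite_singleton _).union (Set.finite_iUnion fun A => finite_subexprs _)
  -- The set adds the starting non-terminal to the subexpressions of the rules. The closure
  -- conditions other than that for non-terminals start from compound expressions, which therefore
  -- lie in some rule.
  have key {e e' : ParsingExpr T G.NT} (h : e' ∈ subexprs e) (hne : e ≠ .nonterminal G.start)
      (he : e ∈ {.nonterminal G.start} ∪ ⋃ A, subexprs (G.rule A)) :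
      e' ∈ ({.nonterminal G.start} ∪ ⋃ A, subexprs (G.rule A) : Set (ParsingExpr T G.NT)) := by
    obtain he | he := he
    · exact absurd he hne
    · obtain ⟨A, he⟩ := Set.mem_iUnion.1 he
      exact .inr (Set.mem_iUnion.2 ⟨A, subexprs_subset he h⟩)
  constructor
  · intro A _
    exact .inr (Set.mem_iUnion.2 ⟨A, mem_subexprs_self _⟩)
  all_goals
    intros
    refine key ?_ ?_ ‹_› <;> simp [subexprs, mem_subexprs_self]

theorem nonempty_indexing (G : PEG T) : Nonempty G.Indexing := by
  obtain ⟨E, hE, hc, hs⟩ := G.exists_finite_isClosed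
  have := hE.to_subtype
  let f := (Finite.equivFin E).symm
  have hr : Set.range (fun i => (f i : ParsingExpr T G.NT)) = E := by
    rw [Set.range_comp' Subtype.val, f.surjective.range_eq, Set.image_univ, Subtype.range_val]
  have : Nonempty (Fin (Nat.card E)) := ⟨f.symm ⟨_, hs⟩⟩
  exact ⟨{
    size := Nat.card E
    expr := fun i => f i
    index := Function.invFun fun i => (f i : ParsingExpr T G.NT)
    expr_index := fun e he => Function.invFun_eq he
    closed := by rw [hr]; exact hc
    start_mem := by rw [hr]; exact hs }⟩

/-! ### Evaluating calls on `a :: z` from the scaffold of `z` -/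

/-- The result of a call, relative to the top node `t` of a scaffold that describes the input
without its first symbol: failure, acceptance of the empty word, or acceptance with the rest of the
input described by the end of a path from `t`. -/
inductive Jump (d : ℕ) where
  | missing : Jump d
  | self : Jump d
  | path (p : List (Fin d)) : Jump d

namespace Indexing

variable {G : PEG T} (I : G.Indexing)

/-- The set of indexed expressions. -/
def exprs : Set (ParsingExpr T G.NT) := Set.range I.expr

open Classical in
/-- The result of calling `e` at the end of the path `p`, where `look p` is the label of the node
at the end of `p`, if there is such a node. -/
noncomputable def advance (look : List (Fin I.size) → Option (Option Unit))
    (p : List (Fin I.size)) (e : ParsingExpr T G.NT) : Jump I.size :=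
  -- An unlabelled end is node 0, which has no edges; calls on the empty word are constants of the
  -- grammar, and an accepting one stays at that node.
  if look p = some none then
    if G.out e [] = none then .missing else .path p
  -- At any other node the call accepts exactly if the corresponding edge exists.
  else if look (p ++ [I.index e]) = none then .missing else .path (p ++ [I.index e])

open Classical in
/-- The result of a call on an input that starts with `a`, when the results `f` of other calls on
the same input are known. -/
noncomputable def evalStep (a : T) (look : List (Fin I.size) → Option (Option Unit))
    (f : ParsingExpr T G.NT → Option (Jump I.size)) : ParsingExpr T G.NT → Option (Jump I.size)
  | .eps => some .self
  | .fail => some .missing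
  | .terminal b => some (if b = a then .path [] else .missing)
  | .nonterminal A => f (G.rule A)
  | .not e => (f e).map fun
    | .missing => .self
    | _ => .missing
  | .and e => (f e).map fun
    | .missing => .missing
    | _ => .self
  | .seq e₁ e₂ => (f e₁).bind fun
    | .missing => some .missing
    | .self => f e₂
    | .path p => some (I.advance look p e₂)
  | .choice e₁ e₂ => (f e₁).bind fun
    | .missing => f e₂
    | c => some c

/-- The result of a call on an input that starts with `a`, as far as it is determined with a
recursion depth of less than `n`. -/
noncomputable def eval (a : T) (look : List (Fin I.size) → Option (Option Unit)) :
    ℕ → ParsingExpr T G.NT → Option (Jump I.size)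
  | 0 => fun _ => none
  | n + 1 => I.evalStep a look (eval a look n)

variable {I} {a : T} {look look' : List (Fin I.size) → Option (Option Unit)}

/-- A step waits for every result it uses, so further knowledge cannot change what is already
determined. -/
theorem evalStep_mono {f g : ParsingExpr T G.NT → Option (Jump I.size)}
    (h : ∀ e c, f e = some c → g e = some c) (e : ParsingExpr T G.NT) (c : Jump I.size)
    (he : I.evalStep a look f e = some c) : I.evalStep a look g e = some c := by
  cases e with
  | eps | fail | terminal => exact he
  | nonterminal A => exact h _ _ he
  | not e | and e =>
    obtain ⟨c', hc, hc'⟩ := Option.map_eq_some_iff.1 he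
    exact Option.map_eq_some_iff.2 ⟨c', h _ _ hc, hc'⟩
  | seq e₁ e₂ | choice e₁ e₂ =>
    obtain ⟨c', hc, hc'⟩ := Option.bind_eq_some_iff.1 he
    refine Option.bind_eq_some_iff.2 ⟨c', h _ _ hc, ?_⟩
    cases c' with
    | missing | self | path => first | exact hc' | exact h _ _ hc'

theorem eval_mono_succ (n : ℕ) (e : ParsingExpr T G.NT) (c : Jump I.size)
    (h : I.eval a look n e = some c) : I.eval a look (n + 1) e = some c := by
  induction n generalizing e c with
  | zero => simp [eval] at h
  | succ n ih => exact evalStep_mono ih e c h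

theorem eval_mono {m n : ℕ} (hmn : m ≤ n) {e : ParsingExpr T G.NT} {c : Jump I.size}
    (h : I.eval a look m e = some c) : I.eval a look n e = some c := by
  induction n, hmn using Nat.le_induction with
  | base => exact h
  | succ n _ ih => exact eval_mono_succ n e c ih

theorem evalStep_congr {f g : ParsingExpr T G.NT → Option (Jump I.size)}
    (h : ∀ e ∈ I.exprs, f e = g e) {e : ParsingExpr T G.NT} (he : e ∈ I.exprs) :
    I.evalStep a look f e = I.evalStep a look g e := by
  cases e with
  | eps | fail | terminal => rfl
  | nonterminal A => exact h _ (I.closed.nonterminal he)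
  | not e => simp only [evalStep, h _ (I.closed.not he)]
  | and e => simp only [evalStep, h _ (I.closed.and he)]
  | seq e₁ e₂ => simp only [evalStep, h _ (I.closed.seq_left he), h _ (I.closed.seq_right he)]
  | choice e₁ e₂ =>
    simp only [evalStep, h _ (I.closed.choice_left he), h _ (I.closed.choice_right he)]

/-- A path begins as the empty path at a terminal, with `n` at least 1; each concatenation adds at
most one edge and uses one level of recursion. -/
theorem length_lt_of_eval {n : ℕ} {e : ParsingExpr T G.NT} {p : List (Fin I.size)}
    (h : I.eval a look n e = some (.path p)) : p.length < n := by
  induction n generalizing e p with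
  | zero => simp [eval] at h
  | succ n ih =>
    rw [eval] at h
    cases e with
    | eps | fail => simp [evalStep] at h
    | terminal b =>
      simp only [evalStep, Option.some.injEq] at h
      split_ifs at h
      cases h
      simp
    | nonterminal A => exact (ih h).trans n.lt_succ_self
    | not e | and e =>
      obtain ⟨c, -, hc⟩ := Option.map_eq_some_iff.1 h
      cases c <;> simp at hc
    | seq e₁ e₂ =>
      obtain ⟨c, hc, hc'⟩ := Option.bind_eq_some_iff.1 h
      cases c with
      | missing => simp at hc'
      | self => exact (ih hc').trans n.lt_succ_self
      | path q =>
        have := ih hc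
        simp only [Option.some.injEq, advance] at hc'
        split_ifs at hc' <;> cases hc' <;> simp <;> omega
    | choice e₁ e₂ =>
      obtain ⟨c, hc, hc'⟩ := Option.bind_eq_some_iff.1 h
      cases c with
      | missing => exact (ih hc').trans n.lt_succ_self
      | self => simp at hc'
      | path q =>
        cases hc'
        exact (ih hc).trans n.lt_succ_self

theorem eval_congr_look {n : ℕ} (h : ∀ p, p.length ≤ n → look p = look' p)
    (e : ParsingExpr T G.NT) : I.eval a look n e = I.eval a look' n e := by
  induction n generalizing e with
  | zero => rfl
  | succ n ih =>
    have ih := funext (ih fun p hp => h p (hp.trans n.le_succ))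
    rw [eval, eval, ih]
    cases e with
    | seq e₁ e₂ =>
      simp only [evalStep]
      cases hc : I.eval a look' n e₁ with
      | none => rfl
      | some c =>
        cases c with
        | missing | self => rfl
        | path p =>
          have hp := length_lt_of_eval hc
          simp only [Option.bind_some, advance, h p (by omega),
            h (p ++ [I.index e₂]) (by simp; omega)]
    | _ => rfl

variable (I) in
open Classical in
/-- The part of the input that is described by the target of an edge, where the edges of the node
that describes the empty word are missing. -/
noncomputable def edge (w : List T) (i : Fin I.size) : Option (List T) :=
  if w = [] then none else G.out (I.expr i) w

variable (I) in
/-- The part of the input that is described by the end of a path. -/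
noncomputable def walk : List T → List (Fin I.size) → Option (List T)
  | w, [] => some w
  | w, i :: p => (I.edge w i).bind fun w' => walk w' p

open Classical in
/-- The label of the node that describes the input `w`. -/
noncomputable def nodeLabel (w : List T) : Option Unit := if w = [] then none else some ()

variable (I) in
/-- The label of the node at the end of a path, if there is such a node. -/
noncomputable def walkLabel (z : List T) (p : List (Fin I.size)) : Option (Option Unit) :=
  (I.walk z p).map nodeLabel

variable (I) in
/-- The rest of the input `a :: z` that a jump indicates. -/
noncomputable def resolve (a : T) (z : List T) : Jump I.size → Option (List T)
  | .missing => none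
  | .self => some (a :: z)
  | .path p => I.walk z p

/-- A jump is valid if it is not a path to a node that does not exist. -/
def Jump.Valid (z : List T) (c : Jump I.size) : Prop := ∀ p, c = .path p → I.walk z p ≠ none

theorem walk_append_singleton (z : List T) (p : List (Fin I.size)) (i : Fin I.size) :
    I.walk z (p ++ [i]) = (I.walk z p).bind fun w => I.edge w i := by
  induction p generalizing z with
  | nil => simp [walk]
  | cons j p ih => simp [walk, ih, Option.bind_assoc]

theorem advance_walkLabel {z : List T} {p : List (Fin I.size)} {w : List T}
    (hp : I.walk z p = some w) {e : ParsingExpr T G.NT} (he : e ∈ I.exprs) :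
    G.out e w = I.resolve a z (I.advance (I.walkLabel z) p e) ∧
      Jump.Valid z (I.advance (I.walkLabel z) p e) := by
  by_cases hw : w = []
  · subst hw
    have hl : I.walkLabel z p = some none := by simp [walkLabel, hp, nodeLabel]
    rw [advance, if_pos hl]
    cases h : G.out e [] with
    | none => simp [resolve, Jump.Valid]
    | some r =>
      obtain rfl := List.suffix_nil.1 (suffix_of_out_eq_some h)
      simp [resolve, hp, Jump.Valid]
  · have hl : I.walkLabel z p ≠ some none := by simp [walkLabel, hp, nodeLabel, hw]
    have hq : I.walk z (p ++ [I.index e]) = G.out e w := by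
      rw [walk_append_singleton, hp, Option.bind_some, edge, if_neg hw, I.expr_index e he]
    rw [advance, if_neg hl]
    simp only [walkLabel, hq]
    cases h : G.out e w <;> simp [resolve, hq, h, Jump.Valid]

/-- Validity belongs to the induction: `evalStep` treats every path as acceptance, whereas a path to
a missing node would resolve to failure. -/
theorem eval_sound (hG : G.IsTotal) {z : List T} {n : ℕ} {e : ParsingExpr T G.NT}
    (he : e ∈ I.exprs) {c : Jump I.size} (h : I.eval a (I.walkLabel z) n e = some c) :
    G.out e (a :: z) = I.resolve a z c ∧ Jump.Valid z c := by
  classical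
  induction n generalizing e c with
  | zero => simp [eval] at h
  | succ n ih =>
    rw [eval] at h
    cases e with
    | eps => cases h; simp [out_eps, resolve, Jump.Valid]
    | fail => cases h; simp [out_fail, resolve, Jump.Valid]
    | terminal b =>
      cases h
      rw [out_terminal_cons]
      split_ifs <;> simp [resolve, Jump.Valid, walk]
    | nonterminal A =>
      rw [hG.out_nonterminal]
      exact ih (I.closed.nonterminal he) h
    | not e =>
      obtain ⟨c', hc, rfl⟩ := Option.map_eq_some_iff.1 h
      obtain ⟨h₁, h₂⟩ := ih (I.closed.not he) hc
      rw [hG.out_not, h₁]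
      cases c' with
      | missing | self => simp [resolve, Jump.Valid]
      | path p => simp [resolve, Jump.Valid, h₂ p rfl]
    | and e =>
      obtain ⟨c', hc, rfl⟩ := Option.map_eq_some_iff.1 h
      obtain ⟨h₁, h₂⟩ := ih (I.closed.and he) hc
      rw [hG.out_and, h₁]
      cases c' with
      | missing | self => simp [resolve, Jump.Valid]
      | path p => simp [resolve, Jump.Valid, h₂ p rfl]
    | seq e₁ e₂ =>
      obtain ⟨c', hc, hc'⟩ := Option.bind_eq_some_iff.1 h
      obtain ⟨h₁, h₂⟩ := ih (I.closed.seq_left he) hc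
      rw [hG.out_seq, h₁]
      cases c' with
      | missing => cases hc'; simp [resolve, Jump.Valid]
      | self => exact ih (I.closed.seq_right he) hc'
      | path p =>
        cases hc'
        obtain ⟨w, hw⟩ := Option.ne_none_iff_exists'.1 (h₂ p rfl)
        rw [resolve, hw, Option.bind_some]
        exact advance_walkLabel hw (I.closed.seq_right he)
    | choice e₁ e₂ =>
      obtain ⟨c', hc, hc'⟩ := Option.bind_eq_some_iff.1 h
      obtain ⟨h₁, h₂⟩ := ih (I.closed.choice_left he) hc
      rw [hG.out_choice, h₁]
      cases c' with
      | missing => exact ih (I.closed.choice_right he) hc'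
      | self => cases hc'; simp [resolve, Jump.Valid]
      | path p =>
        cases hc'
        obtain ⟨w, hw⟩ := Option.ne_none_iff_exists'.1 (h₂ p rfl)
        simp [resolve, hw, Jump.Valid]

/-- Induction on the derivation of the call. Subcalls on the same input are covered by the induction
hypotheses; those made after `a` is consumed are looked up along edges and need no recursion. -/
theorem exists_eval_eq_some (hG : G.IsTotal) {z x : List T} {e : ParsingExpr T G.NT}
    {r : Option (List T)} (h : G.Rec e x r) (hx : x = a :: z) (he : e ∈ I.exprs) :
    ∃ n c, I.eval a (I.walkLabel z) n e = some c := by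
  induction h with
  | eps | fail | terminal | terminal_fail => exact ⟨1, _, rfl⟩
  | nonterminal _ ih =>
    obtain ⟨n, c, h⟩ := ih hx (I.closed.nonterminal he)
    exact ⟨n + 1, c, h⟩
  | not_of_fail _ ih | not_of_accept _ ih =>
    obtain ⟨n, c, h⟩ := ih hx (I.closed.not he)
    exact ⟨n + 1, _, by rw [eval, evalStep, h, Option.map_some]⟩
  | and_of_fail _ ih | and_of_accept _ ih =>
    obtain ⟨n, c, h⟩ := ih hx (I.closed.and he)
    exact ⟨n + 1, _, by rw [eval, evalStep, h, Option.map_some]⟩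
  | seq h₁ _ ih₁ ih₂ | seq_fail_right h₁ _ ih₁ ih₂ =>
    obtain ⟨n, c, h⟩ := ih₁ hx (I.closed.seq_left he)
    cases c with
    | missing | path => exact ⟨n + 1, _, by rw [eval, evalStep, h, Option.bind_some]⟩
    | self =>
      -- The first call consumed nothing, so the second one has the input `a :: z` again and its
      -- induction hypothesis applies.
      have hz := (eval_sound hG (I.closed.seq_left he) h).1
      rw [← hx, h₁.out_eq] at hz
      simp only [Option.map_some, List.drop_left, resolve, Option.some.injEq] at hz
      obtain ⟨m, c, h'⟩ := ih₂ hz (I.closed.seq_right he)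
      refine ⟨max n m + 1, c, ?_⟩
      rw [eval, evalStep, eval_mono (le_max_left n m) h, Option.bind_some]
      exact eval_mono (le_max_right n m) h'
  | seq_fail_left h₁ ih =>
    obtain ⟨n, c, h⟩ := ih hx (I.closed.seq_left he)
    have hz := (eval_sound hG (I.closed.seq_left he) h).1
    rw [← hx, h₁.out_eq] at hz
    cases c with
    | missing | path => exact ⟨n + 1, _, by rw [eval, evalStep, h, Option.bind_some]⟩
    | self => simp [resolve] at hz
  | choice_left h₁ ih =>
    obtain ⟨n, c, h⟩ := ih hx (I.closed.choice_left he)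
    have hz := (eval_sound hG (I.closed.choice_left he) h).1
    rw [← hx, h₁.out_eq] at hz
    cases c with
    | self | path => exact ⟨n + 1, _, by rw [eval, evalStep, h, Option.bind_some]⟩
    | missing => simp [resolve] at hz
  | choice_right h₁ _ ih₁ ih₂ =>
    obtain ⟨n, c, h⟩ := ih₁ hx (I.closed.choice_left he)
    cases c with
    | self | path => exact ⟨n + 1, _, by rw [eval, evalStep, h, Option.bind_some]⟩
    | missing =>
      obtain ⟨m, c, h'⟩ := ih₂ hx (I.closed.choice_right he)
      refine ⟨max n m + 1, c, ?_⟩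
      rw [eval, evalStep, eval_mono (le_max_left n m) h, Option.bind_some]
      exact eval_mono (le_max_right n m) h'

/-- Evaluation reaches every result that it can reach with a recursion depth of less than the
number of expressions. -/
theorem eval_size_ne_none {n : ℕ} {i : Fin I.size} (h : I.eval a look n (I.expr i) ≠ none) :
    I.eval a look I.size (I.expr i) ≠ none := by
  classical
  let D (m : ℕ) : Finset (Fin I.size) := {i | I.eval a look m (I.expr i) ≠ none}
  have mem_D (m : ℕ) (i : Fin I.size) : i ∈ D m ↔ I.eval a look m (I.expr i) ≠ none := by
    simp [D]
  have hD : Monotone D := by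
    intro m n hmn i hi
    rw [mem_D] at hi ⊢
    obtain ⟨c, hc⟩ := Option.ne_none_iff_exists'.1 hi
    simp [eval_mono hmn hc]
  -- If one round adds no expression, then by closedness the next round evaluates from the same data
  -- and adds none either.
  have stable (m : ℕ) (hm : (D m).card = (D (m + 1)).card) :
      (D (m + 1)).card = (D (m + 1 + 1)).card := by
    have hm := Finset.eq_of_subset_of_card_le (hD m.le_succ) hm.ge
    have heq (e : ParsingExpr T G.NT) (he : e ∈ I.exprs) :
        I.eval a look m e = I.eval a look (m + 1) e := by
      obtain ⟨i, rfl⟩ := he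
      cases h : I.eval a look m (I.expr i) with
      | none =>
        have : i ∉ D (m + 1) := by simp [← hm, mem_D, h]
        rw [mem_D, not_not] at this
        rw [this]
      | some c => rw [eval_mono m.le_succ h]
    congr 1
    ext i
    rw [mem_D, mem_D, eval, eval, evalStep_congr heq ⟨i, rfl⟩]
  -- The cardinalities are bounded by `I.size` and stay constant once they stall, hence are constant
  -- from round `I.size` on.
  have hcard := Nat.stabilises_of_monotone (f := fun m => (D m).card) (b := I.size)
    (n := max n I.size) (fun m n hmn => Finset.card_le_card (hD hmn))
    (fun m => (Finset.card_le_univ _).trans_eq (Fintype.card_fin _)) stable (le_max_right _ _)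
  have := Finset.eq_of_subset_of_card_le (hD (le_max_right n I.size)) hcard.le
  rw [← mem_D, this]
  exact hD (le_max_left _ _) ((mem_D _ _).2 h)

theorem exists_eval_eq (hG : G.IsTotal) (a : T) (z : List T) (i : Fin I.size) :
    ∃ c, I.eval a (I.walkLabel z) I.size (I.expr i) = some c ∧
      G.out (I.expr i) (a :: z) = I.resolve a z c := by
  obtain ⟨r, hr⟩ := hG (I.expr i) (a :: z)
  obtain ⟨n, c, h⟩ := exists_eval_eq_some (I := I) hG hr rfl ⟨i, rfl⟩
  obtain ⟨c, hc⟩ := Option.ne_none_iff_exists'.1 (eval_size_ne_none (n := n) (by rw [h]; simp))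
  exact ⟨c, hc, (eval_sound hG ⟨i, rfl⟩ hc).1⟩

end Indexing

end PEG

/-! ### The simulating automaton -/

/-- The label of the node at the end of the path `p`, if there is such a node, in a scaffold in
which the neighbourhood of the start of `p` is known. -/
def NeighbourhoodOrNone.look {d : ℕ} {Γ : Type*} :
    (k : ℕ) → NeighbourhoodOrNone d Γ k → List (Fin d) → Option (Option Γ)
  | 0, _, _ => none
  | _ + 1, none, _ => none
  | _ + 1, some N, [] => some N.1
  | k + 1, some N, i :: p => look k (N.2 i) p

/-- The inequality is strict because depth 0 does not distinguish a missing node from an unlabelled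
one. -/
theorem Scaffold.look_neighbourhoodOrNone {d : ℕ} {Γ : Type*} (S : Scaffold d Γ) {k : ℕ}
    {v : Option ℕ} {p : List (Fin d)} (hp : p.length < k) :
    (S.neighbourhoodOrNone k v).look k p = (S.follow v p).map S.label := by
  induction k generalizing v p with
  | zero => simp at hp
  | succ k ih =>
    cases v with
    | none => rw [follow_none]; rfl
    | some v =>
      cases p with
      | nil => rfl
      | cons i p =>
        rw [follow_some_cons, ← ih (by simpa using hp)]
        rfl

namespace PEG

/-- The edge that a jump asks for; paths that are too long are discarded. -/
def Jump.toEdgeChoice {d : ℕ} (k : ℕ) : Jump d → EdgeChoice d k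
  | .missing => .missing
  | .self => .self
  | .path p => if hp : p.length ≤ k then .path p hp else .missing

namespace Indexing

variable {T : Type*} {G : PEG T} (I : G.Indexing)

/-- The index of the starting non-terminal. -/
def startIndex : Fin I.size := I.index (.nonterminal G.start)

theorem expr_startIndex : I.expr I.startIndex = .nonterminal G.start :=
  I.expr_index _ I.start_mem

/-- The result of the call on the expression with index `i`, if the next symbol is `a` and the top
node has the neighbourhood `N`. -/
noncomputable def jump (a : T) (N : Neighbourhood I.size Unit (I.size + 1)) (i : Fin I.size) :
    Jump I.size :=
  -- The default is never used on actual neighbourhoods of a total grammar.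
  (I.eval a (NeighbourhoodOrNone.look (I.size + 1) (N.toOrNone _)) I.size (I.expr i)).getD .missing

open Classical in
/-- A scaffolding automaton that simulates `G` on the reverse of its input. -/
noncomputable abbrev toAutomaton : ScaffoldingAutomaton T where
  degree := I.size
  one_le_degree := Fin.pos I.startIndex
  Γ := Unit
  finite_Γ := inferInstance
  -- Evaluation looks up paths of length up to `I.size`, and their last label requires one more
  -- level.
  distance := I.size + 1
  Q := Bool
  finite_Q := inferInstance
  δ _ a N :=
    (match I.jump a N I.startIndex with
      -- The whole input is consumed exactly if the path ends at node 0; a self-jump leaves a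
      -- non-empty rest.
      | .path p => NeighbourhoodOrNone.look (I.size + 1) (N.toOrNone _) p = some none
      | _ => false,
      (), fun i => (I.jump a N i).toEdgeChoice (I.size + 1))
  q₀ := G.out (.nonterminal G.start) [] = some []
  F := {true}

/-- The edges of the top node of the scaffold describe the results of calls on the input `z`. -/
def Describes (z : List T) : Prop :=
  ∀ i, (I.toAutomaton.scaffold z).edge z.length i = (I.edge z i).map List.length

variable {I}

theorem label_scaffold_toAutomaton (z : List T) :
    (I.toAutomaton.scaffold z).label z.length = nodeLabel z := by
  cases z with
  | nil => simp [nodeLabel, I.toAutomaton.scaffold_nil, Scaffold.initial]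
  | cons a z =>
    rw [I.toAutomaton.label_scaffold_cons, nodeLabel, if_neg (by simp)]

theorem edge_suffix {w r : List T} {i : Fin I.size} (h : I.edge w i = some r) : r <:+ w := by
  rw [edge] at h
  split_ifs at h
  exact suffix_of_out_eq_some h

theorem walk_suffix {w r : List T} {p : List (Fin I.size)} (h : I.walk w p = some r) :
    r <:+ w := by
  induction p generalizing w with
  | nil => cases h; exact List.suffix_rfl
  | cons i p ih =>
    obtain ⟨w', h₁, h₂⟩ := Option.bind_eq_some_iff.1 h
    exact (ih h₂).trans (edge_suffix h₁)

theorem follow_scaffold_toAutomaton {z : List T} (hz : ∀ w, w <:+ z → I.Describes w)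
    {w : List T} (hw : w <:+ z) (p : List (Fin I.size)) :
    (I.toAutomaton.scaffold z).follow (some w.length) p = (I.walk w p).map List.length := by
  induction p generalizing w with
  | nil => rfl
  | cons i p ih =>
    rw [Scaffold.follow_some_cons, I.toAutomaton.edge_scaffold_of_suffix hw, hz w hw i, walk]
    cases h : I.edge w i with
    | none => exact Scaffold.follow_none _ _
    | some r => exact ih ((edge_suffix h).trans hw)

theorem look_situation {z : List T} (hz : ∀ w, w <:+ z → I.Describes w) (a : T)
    {p : List (Fin I.size)} (hp : p.length ≤ I.size) :
    NeighbourhoodOrNone.look (I.size + 1)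
      ((I.toAutomaton.situation z a).2.2.toOrNone _) p = I.walkLabel z p := by
  change NeighbourhoodOrNone.look (I.size + 1) (Neighbourhood.toOrNone (I.size + 1)
    ((I.toAutomaton.scaffold z).neighbourhood _ _)) p = _
  rw [← Scaffold.neighbourhoodOrNone_some, Scaffold.look_neighbourhoodOrNone _ (by omega),
    I.toAutomaton.top_scaffold, follow_scaffold_toAutomaton hz List.suffix_rfl, walkLabel]
  cases h : I.walk z p with
  | none => rfl
  | some w =>
    simp only [Option.map_some, I.toAutomaton.label_scaffold_of_suffix (walk_suffix h),
      label_scaffold_toAutomaton]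

theorem jump_situation (hG : G.IsTotal) {z : List T} (hz : ∀ w, w <:+ z → I.Describes w) (a : T)
    (i : Fin I.size) :
    G.out (I.expr i) (a :: z) = I.resolve a z (I.jump a (I.toAutomaton.situation z a).2.2 i) ∧
      ∀ p, I.jump a (I.toAutomaton.situation z a).2.2 i = .path p → p.length < I.size := by
  obtain ⟨c, hc, h⟩ := exists_eval_eq (I := I) hG a z i
  have : I.jump a (I.toAutomaton.situation z a).2.2 i = c := by
    rw [jump, eval_congr_look fun p hp => look_situation hz a hp, hc, Option.getD_some]
  rw [this]
  refine ⟨h, ?_⟩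
  rintro p rfl
  exact length_lt_of_eval hc

/-- The jump found by evaluation resolves to the rest of the input left by the call, and its path is
short enough to be followed by the automaton rather than discarded. -/
theorem describes_cons (hG : G.IsTotal) {z : List T} (hz : ∀ w, w <:+ z → I.Describes w)
    (a : T) : I.Describes (a :: z) := by
  intro i
  obtain ⟨h, hp⟩ := jump_situation hG hz a i
  rw [I.toAutomaton.edge_scaffold_cons, edge, if_neg (by simp), h]
  change (I.toAutomaton.scaffold z).target
    ((I.jump a (I.toAutomaton.situation z a).2.2 i).toEdgeChoice (I.size + 1)) = _
  cases hc : I.jump a (I.toAutomaton.situation z a).2.2 i with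
  | missing => rfl
  | self => simp [Jump.toEdgeChoice, Scaffold.target, I.toAutomaton.top_scaffold, resolve]
  | path p =>
    have := hp p hc
    rw [Jump.toEdgeChoice, dif_pos (by omega), Scaffold.target, I.toAutomaton.top_scaffold,
      follow_scaffold_toAutomaton hz List.suffix_rfl, resolve]

theorem describes_of_isTotal (hG : G.IsTotal) (z : List T) : ∀ w, w <:+ z → I.Describes w := by
  induction z with
  | nil =>
    intro w hw i
    rw [List.suffix_nil.1 hw]
    simp [I.toAutomaton.scaffold_nil, Scaffold.initial, edge]
  | cons a z ih =>
    intro w hw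
    obtain rfl | hw := List.suffix_cons_iff.1 hw
    exacts [describes_cons hG ih a, ih w hw]

theorem state_toAutomaton (hG : G.IsTotal) (z : List T) :
    I.toAutomaton.state z = true ↔ z ∈ G.language := by
  rw [hG.mem_language_iff]
  cases z with
  | nil => simp [I.toAutomaton.state_nil]
  | cons a z =>
    have hz := describes_of_isTotal (I := I) hG z
    obtain ⟨h, hp⟩ := jump_situation hG hz a I.startIndex
    rw [I.toAutomaton.state_cons, ← expr_startIndex, h]
    change (match I.jump a (I.toAutomaton.situation z a).2.2 I.startIndex with
      | .path p => _
      | _ => _) = true ↔ _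
    cases hc : I.jump a (I.toAutomaton.situation z a).2.2 I.startIndex with
    | missing => simp [resolve]
    | self => simp [resolve]
    | path p =>
      simp only [look_situation hz a (hp p hc).le, decide_eq_true_eq, resolve, walkLabel]
      cases hw : I.walk z p with
      | none => simp
      | some w => simp [nodeLabel]

end Indexing

end PEG

theorem mainTheorem1 {T : Type*} [Finite T] (L : Language T) :
    L ∈ PEGLanguages T ↔ ∃ A : ScaffoldingAutomaton T, A.language = L.reverse := by
  constructor
  · rintro ⟨G, hG, rfl⟩
    obtain ⟨I⟩ := G.nonempty_indexing
    refine ⟨I.toAutomaton, Set.ext fun x => ?_⟩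
    have h := PEG.Indexing.state_toAutomaton (I := I) hG x.reverse
    rw [ScaffoldingAutomaton.state, List.reverse_reverse] at h
    exact h
  · rintro ⟨A, hA⟩
    refine ⟨A.toPEG, A.isTotal_toPEG, Set.ext fun x => ?_⟩
    refine (ScaffoldingAutomaton.mem_language_toPEG x).trans ?_
    change x.reverse ∈ A.language ↔ x ∈ L
    rw [hA, Language.mem_reverse, List.reverse_reverse]
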